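/- Let $p\ge 3$ and $n\ge 0$. The Hanoi graph $H_p^n$ has as vertices the $p^n$ maps $\tau$ from the discs $\{d_1,\dots,d_n\}$ (where $d_i$ is smaller than $d_j$ for $i<j$) to the pegs $\{1,\dots,p\}$; two configurations are adjacent if they differ by one legal move, i.e. by moving one disc $d_i$ from a peg to a different peg such that no disc smaller than $d_i$ lies on either of the two pegs. Let $G=(V,E)$ be a finite graph and let $A$ be the set of arcs obtained by directing each edge of $E$ both ways. A uniform multicommodity flow in $G$ is a family of functions $f_{st}\colon A\to\mathbb{R}_{\ge 0}$, $(s,t)\in V\times V$, with $f_{ss}=0$ and such that for all $s\ne t$: (i) $\sum_{v\in N(s)}f_{st}(s,v)=\sum_{v\in N(t)}f_{st}(v,t)=1$, and no flow enters $s$ or leaves $t$, i.e. $f_{st}(v,s)=0$ for all $v\in N(s)$ and $f_{st}(t,v)=0$ for all $v\in N(t)$; (ii) $\sum_{u\in N(v)}f_{st}(u,v)=\sum_{w\in N(v)}f_{st}(v,w)$ for all $v\in V\setminus\{s,t\}$. Its congestion is $\frac1{|V|}\max_{(u,v)\in A}\sum_{(s,t)\in V\times V}f_{st}(u,v)$ (and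 $0$ if $A=\emptyset$). The expansion of $G$, for $|V|\ge 2$, is $h(G)=\min\{|\partial S|/|S| : \emptyset\ne S\subseteq V,\ |S|\le |V|/2\}$, where $\partial S$ is the set of edges between $S$ and $V\setminus S$. Lemma. For every fixed $p\ge 3$ there is a constant $C=C(p)>0$ such that for all $n\ge 1$ and all real $\rho$: if $H_p^{n-1}$ has a uniform multicommodity flow with congestion at most $\rho$, then $H_p^n$ has a uniform multicommodity flow with congestion at most $$\rho+C\left(\frac{p}{p-2}\right)^n .$$ Consequently, for every fixed $p\ge 3$ there is a constant $c=c(p)>0$ such that $h(H_p^n)\ge c\left(\frac{p-2}{p}\right)^n$ for all $n\ge 1$. -/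

import Mathlib

namespace Hanoi

/-- The Hanoi graph `H_p^n`. A configuration `τ : Fin n → Fin p` assigns a peg to every disc, and
disc `d` is smaller than disc `e` when `d < e`. Two configurations are adjacent when they differ by
moving exactly one disc `d`, where no smaller disc lies on the peg that `d` leaves (so that `d` is on
top of its peg) or on the peg that `d` goes to. -/
def hanoiGraph (p n : ℕ) : SimpleGraph (Fin n → Fin p) where
  Adj τ₁ τ₂ := ∃ d : Fin n, τ₁ d ≠ τ₂ d ∧ (∀ e, e ≠ d → τ₁ e = τ₂ e) ∧
    ∀ e, e < d → τ₁ e ≠ τ₁ d ∧ τ₁ e ≠ τ₂ d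
  symm := ⟨by
    rintro τ₁ τ₂ ⟨d, hd, he, hs⟩
    refine ⟨d, hd.symm, fun e h => (he e h).symm, fun e h => ?_⟩
    rw [← he e h.ne]
    exact ⟨(hs e h).2, (hs e h).1⟩⟩
  loopless := ⟨by
    rintro τ ⟨d, hd, -⟩
    exact hd rfl⟩

instance (p n : ℕ) : DecidableRel (hanoiGraph p n).Adj := fun τ₁ τ₂ =>
  inferInstanceAs (Decidable (∃ d : Fin n, τ₁ d ≠ τ₂ d ∧ (∀ e, e ≠ d → τ₁ e = τ₂ e) ∧
    ∀ e, e < d → τ₁ e ≠ τ₁ d ∧ τ₁ e ≠ τ₂ d))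

/-- `f` is a uniform multicommodity flow in `G`: `f s t u v` is the amount of the commodity `(s, t)`
that is sent along the arc `(u, v)`, and for all `s ≠ t` one unit goes from `s` to `t`. Functions on
the arcs are extended by zero to all pairs of vertices. The conditions `source_in` and `sink_out`
(no flow of the commodity `(s, t)` enters `s` or leaves `t`) make sure that the unit leaving `s` is
the unit arriving in `t`: without them, two disjoint circulations, one through `s` and one through
`t`, would be admitted. A pair `(s, s)` has nothing to send. -/
structure IsUniformFlow {V : Type*} [Fintype V] (G : SimpleGraph V) [DecidableRel G.Adj]
    (f : V → V → V → V → ℝ) : Prop where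
  nonneg : ∀ s t u v, 0 ≤ f s t u v
  supported : ∀ s t u v, ¬ G.Adj u v → f s t u v = 0
  diag : ∀ s u v, f s s u v = 0
  source_out : ∀ s t, s ≠ t → ∑ v ∈ G.neighborFinset s, f s t s v = 1
  sink_in : ∀ s t, s ≠ t → ∑ v ∈ G.neighborFinset t, f s t v t = 1
  source_in : ∀ s t, s ≠ t → ∀ v, f s t v s = 0
  sink_out : ∀ s t, s ≠ t → ∀ v, f s t t v = 0
  conserved : ∀ s t, s ≠ t → ∀ v, v ≠ s → v ≠ t →
    ∑ u ∈ G.neighborFinset v, f s t u v = ∑ w ∈ G.neighborFinset v, f s t v w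

/-- The congestion of `f`: the largest total flow along an arc, divided by the number of vertices
(it is `0` for a graph without arcs). -/
noncomputable def congestion {V : Type*} [Fintype V] (G : SimpleGraph V)
    (f : V → V → V → V → ℝ) : ℝ :=
  (1 / (Fintype.card V : ℝ)) * ⨆ a : G.Dart, ∑ s : V, ∑ t : V, f s t a.fst a.snd

/-- The edge expansion of `G`: the minimum of `|∂S| / |S|` over the nonempty `S ⊆ V` with
`|S| ≤ |V| / 2`, where `∂S` is the set of edges `(u, v)` with `u ∈ S` and `v ∉ S`. (Such sets `S`
exist as soon as `G` has at least two vertices.) -/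
noncomputable def expansion {V : Type*} [Fintype V] [DecidableEq V] (G : SimpleGraph V)
    [DecidableRel G.Adj] : ℝ :=
  ⨅ S : {S : Finset V // S.Nonempty ∧ 2 * S.card ≤ Fintype.card V},
    ((G.interedges S.1 S.1ᶜ).card : ℝ) / (S.1.card : ℝ)

end Hanoi

namespace Hanoi

open Finset

/-! The graph on n + 1 discs consists of p copies of the graph on n discs, one for each peg of the
largest disc. Copies a and b are joined by a matching on the (p - 2)^n configurations that avoid
both pegs. A commodity inside one copy follows the given flow. A commodity from copy a to copy b
spreads its unit evenly over the configurations avoiding a and b, crosses the matching, and runs the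
spreading flow of its target backwards.

Everything rests on spreading cheaply: the flows of all sources together load an arc by at most p (p
/ (p - 2))^n (`exists_concentrate`). This recursion relies on `exists_shift`, which replaces one of
the two avoided pegs with load 1, independently of n. The added congestion is geometric in n, so it
sums to O((p / (p - 2))^n), and the cut bound `IsUniformFlow.le_expansion` converts this into
expansion. -/

/-- `F` is a nonnegative flow along the arcs of `G` whose net outflow at `u` is `d u`. -/
structure Transports {V : Type*} [Fintype V] (G : SimpleGraph V) (F : V → V → ℝ) (d : V → ℝ) :
    Prop where
  nonneg : ∀ u v, 0 ≤ F u v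
  supported : ∀ u v, ¬ G.Adj u v → F u v = 0
  net : ∀ u, ∑ v, F u v - ∑ v, F v u = d u

/-! ### Linear combinations and reversal of flows -/

namespace Transports

variable {V : Type*} [Fintype V] {G : SimpleGraph V} {F F' : V → V → ℝ} {d d' : V → ℝ}

theorem zero : Transports G (fun _ _ => 0) (fun _ => 0) where
  nonneg _ _ := le_rfl
  supported _ _ _ := rfl
  net _ := by simp

theorem add (h : Transports G F d) (h' : Transports G F' d') :
    Transports G (fun u v => F u v + F' u v) (fun u => d u + d' u) where
  nonneg u v := add_nonneg (h.nonneg u v) (h'.nonneg u v)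
  supported u v n := by rw [h.supported u v n, h'.supported u v n, add_zero]
  net u := by
    rw [← h.net u, ← h'.net u, sum_add_distrib, sum_add_distrib]
    ring

theorem smul (h : Transports G F d) {c : ℝ} (hc : 0 ≤ c) :
    Transports G (fun u v => c * F u v) (fun u => c * d u) where
  nonneg u v := mul_nonneg hc (h.nonneg u v)
  supported u v n := by rw [h.supported u v n, mul_zero]
  net u := by rw [← h.net u, ← mul_sum, ← mul_sum, mul_sub]

theorem sum {ι : Type*} (s : Finset ι) {F : ι → V → V → ℝ} {d : ι → V → ℝ}
    (h : ∀ i ∈ s, Transports G (F i) (d i)) :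
    Transports G (fun u v => ∑ i ∈ s, F i u v) (fun u => ∑ i ∈ s, d i u) where
  nonneg u v := sum_nonneg fun i hi => (h i hi).nonneg u v
  supported u v n := sum_eq_zero fun i hi => (h i hi).supported u v n
  net u := by
    rw [sum_comm, sum_comm (s := univ) (t := s), ← sum_sub_distrib]
    exact sum_congr rfl fun i hi => (h i hi).net u

theorem reverse (h : Transports G F d) : Transports G (fun u v => F v u) (fun u => -d u) where
  nonneg u v := h.nonneg v u
  supported u v n := h.supported v u fun a => n a.symm
  net u := by rw [← h.net u, neg_sub]

theorem congr (h : Transports G F d) (hd : ∀ u, d u = d' u) : Transports G F d' :=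
  (funext hd : d = d') ▸ h

end Transports

/-! ### Decomposition by the peg of the largest disc -/

/-- The indicator of the configurations that leave the pegs `a` and `b` empty. -/
noncomputable def avoidInd {p n : ℕ} (a b : Fin p) (σ : Fin n → Fin p) : ℝ :=
  if ∀ i, σ i ≠ a ∧ σ i ≠ b then 1 else 0

theorem avoidInd_comm {p n : ℕ} (a b : Fin p) (σ : Fin n → Fin p) :
    avoidInd a b σ = avoidInd b a σ := by
  simp only [avoidInd, and_comm]

theorem avoidInd_snoc {p n : ℕ} (a b e : Fin p) (σ : Fin n → Fin p) :
    avoidInd a b (Fin.snoc σ e : Fin (n + 1) → Fin p) =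
      if e = a ∨ e = b then 0 else avoidInd a b σ := by
  simp only [avoidInd, Fin.forall_fin_succ', Fin.snoc_castSucc, Fin.snoc_last]
  split_ifs <;> tauto

theorem sum_snoc {p n : ℕ} (F : (Fin (n + 1) → Fin p) → ℝ) :
    ∑ u, F u = ∑ e, ∑ σ : Fin n → Fin p, F (Fin.snoc σ e) := by
  rw [← Fintype.sum_prod_type']
  exact ((Fin.snocEquiv fun _ => Fin p).sum_comp F).symm

theorem forall_snoc {p n : ℕ} {P : (Fin (n + 1) → Fin p) → Prop}
    (h : ∀ (σ : Fin n → Fin p) (e : Fin p), P (Fin.snoc σ e)) (u : Fin (n + 1) → Fin p) : P u := by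
  rw [← Fin.snoc_init_self u]
  exact h _ _

theorem snoc_inj {p n : ℕ} {σ τ : Fin n → Fin p} {e e' : Fin p} :
    (Fin.snoc σ e : Fin (n + 1) → Fin p) = Fin.snoc τ e' ↔ σ = τ ∧ e = e' :=
  Fin.snoc_inj

theorem adj_snoc_same {p n : ℕ} {σ τ : Fin n → Fin p} (e : Fin p)
    (h : (hanoiGraph p n).Adj σ τ) :
    (hanoiGraph p (n + 1)).Adj (Fin.snoc σ e) (Fin.snoc τ e) := by
  obtain ⟨d, hd, he, hs⟩ := h
  refine ⟨d.castSucc, by simpa using hd, ?_, ?_⟩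
  · refine Fin.lastCases (by simp) fun i hi => ?_
    simpa using he i fun h => hi (by rw [h])
  · refine Fin.lastCases (fun h => absurd h (not_lt.2 (Fin.le_last _))) fun i hi => ?_
    simpa using hs i (by simpa using hi)

theorem adj_snoc_of_avoid {p n : ℕ} {σ : Fin n → Fin p} {x y : Fin p} (hxy : x ≠ y)
    (h : ∀ i, σ i ≠ x ∧ σ i ≠ y) :
    (hanoiGraph p (n + 1)).Adj (Fin.snoc σ x) (Fin.snoc σ y) := by
  refine ⟨Fin.last n, by simpa using hxy, ?_, ?_⟩
  · exact Fin.lastCases (fun h => absurd rfl h) fun i _ => by simp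
  · exact Fin.lastCases (fun h => absurd h (lt_irrefl _)) fun i _ => by simpa using h i

/-- The flow that follows `G e` in the copy of the smaller graph in which the largest disc lies on
the peg `e`, and that sends `w x y` along every move of the largest disc from `x` to `y`. -/
noncomputable def glue {p n : ℕ} (G : Fin p → (Fin n → Fin p) → (Fin n → Fin p) → ℝ)
    (w : Fin p → Fin p → ℝ) (u v : Fin (n + 1) → Fin p) : ℝ :=
  if u (Fin.last n) = v (Fin.last n) then G (u (Fin.last n)) (Fin.init u) (Fin.init v)
  else if Fin.init (α := fun _ => Fin p) u = Fin.init v then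
    avoidInd (u (Fin.last n)) (v (Fin.last n)) (Fin.init u : Fin n → Fin p) *
      w (u (Fin.last n)) (v (Fin.last n))
  else 0

section glue

variable {p n : ℕ} {G : Fin p → (Fin n → Fin p) → (Fin n → Fin p) → ℝ} {w : Fin p → Fin p → ℝ}

theorem glue_snoc (σ τ : Fin n → Fin p) (x y : Fin p) :
    glue G w (Fin.snoc σ x) (Fin.snoc τ y) =
      if x = y then G x σ τ else if σ = τ then avoidInd x y σ * w x y else 0 := by
  simp [glue]

theorem sum_glue_right (σ : Fin n → Fin p) (x : Fin p) :
    ∑ v, glue G w (Fin.snoc σ x) v =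
      ∑ τ, G x σ τ + ∑ y, (if x = y then 0 else avoidInd x y σ * w x y) := by
  simp_rw [sum_snoc, glue_snoc]
  have h : ∀ y, ∑ τ, (if x = y then G x σ τ else if σ = τ then avoidInd x y σ * w x y else 0) =
      (if x = y then ∑ τ, G x σ τ else 0) + if x = y then 0 else avoidInd x y σ * w x y := by
    intro y
    split_ifs <;> simp
  simp_rw [h, sum_add_distrib]
  simp

theorem sum_glue_left (σ : Fin n → Fin p) (x : Fin p) :
    ∑ v, glue G w v (Fin.snoc σ x) =
      ∑ τ, G x τ σ + ∑ y, (if x = y then 0 else avoidInd x y σ * w y x) := by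
  simp_rw [sum_snoc, glue_snoc]
  have h : ∀ y, ∑ τ, (if y = x then G y τ σ else if τ = σ then avoidInd y x τ * w y x else 0) =
      (if x = y then ∑ τ, G x τ σ else 0) + if x = y then 0 else avoidInd x y σ * w y x := by
    intro y
    rcases eq_or_ne x y with rfl | hy
    · simp
    · simp [hy, hy.symm, avoidInd_comm y x]
  simp_rw [h, sum_add_distrib]
  simp

theorem avoidInd_nonneg (a b : Fin p) (σ : Fin n → Fin p) : 0 ≤ avoidInd a b σ := by
  unfold avoidInd
  split_ifs <;> norm_num

theorem Transports.glue {d : Fin p → (Fin n → Fin p) → ℝ}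
    (hG : ∀ e, Transports (hanoiGraph p n) (G e) (d e)) (hw : ∀ x y, 0 ≤ w x y)
    {D : (Fin (n + 1) → Fin p) → ℝ}
    (hD : ∀ σ x, D (Fin.snoc σ x) = d x σ + ∑ y, avoidInd x y σ * (w x y - w y x)) :
    Transports (hanoiGraph p (n + 1)) (glue G w) D where
  nonneg := forall_snoc fun σ x => forall_snoc fun τ y => by
    rw [glue_snoc]
    split_ifs
    exacts [(hG x).nonneg σ τ, mul_nonneg (avoidInd_nonneg _ _ _) (hw x y), le_rfl]
  supported := forall_snoc fun σ x => forall_snoc fun τ y => fun h => by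
    rw [glue_snoc]
    split_ifs with h1 h2
    · subst h1
      exact (hG x).supported σ τ fun h' => h (adj_snoc_same x h')
    · subst h2
      rw [avoidInd, if_neg fun h' => h (adj_snoc_of_avoid h1 h'), zero_mul]
    · rfl
  net := forall_snoc fun σ x => by
    rw [sum_glue_right, sum_glue_left, hD, ← (hG x).net, add_sub_add_comm]
    congr 1
    rw [← sum_sub_distrib]
    refine sum_congr rfl fun y _ => ?_
    split_ifs with h
    · subst h
      simp
    · rw [mul_sub]

/-- An arc lies in one copy or is a move of the largest disc, never both, so loads of the pieces do
not add up. -/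
theorem glue_le {M : ℝ} (hM : 0 ≤ M) (hG : ∀ e u v, G e u v ≤ M) (hw : ∀ x y, w x y ≤ M)
    (u v : Fin (n + 1) → Fin p) : glue G w u v ≤ M := by
  unfold glue
  split_ifs
  · exact hG _ _ _
  · unfold avoidInd
    split_ifs
    · simpa using hw _ _
    · simpa using hM
  · exact hM

theorem sum_glue {ι : Type*} (s : Finset ι)
    (G : ι → Fin p → (Fin n → Fin p) → (Fin n → Fin p) → ℝ) (w : ι → Fin p → Fin p → ℝ)
    (u v : Fin (n + 1) → Fin p) :
    ∑ i ∈ s, Hanoi.glue (G i) (w i) u v =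
      Hanoi.glue (fun e u v => ∑ i ∈ s, G i e u v) (fun x y => ∑ i ∈ s, w i x y) u v := by
  unfold Hanoi.glue
  split_ifs <;> simp [mul_sum]

end glue

/-! ### Shifting and spreading mass over configurations with two empty pegs -/

/-- Configurations avoiding `z` and `x` can be moved to configurations avoiding `z` and `y` with at
most one unit of flow on each arc. -/
theorem exists_shift {p : ℕ} (n : ℕ) (z x y : Fin p) (hx : z ≠ x) (hy : z ≠ y) :
    ∃ F, Transports (hanoiGraph p n) F (fun u => avoidInd z x u - avoidInd z y u) ∧
      ∀ u v, F u v ≤ 1 := by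
  induction n generalizing z x y with
  | zero => exact ⟨_, Transports.zero.congr fun u => by simp [avoidInd], fun _ _ => zero_le_one⟩
  | succ n ih =>
    rcases eq_or_ne x y with rfl | hxy
    · exact ⟨_, Transports.zero.congr fun u => by simp, fun _ _ => zero_le_one⟩
    -- Copy y must be emptied into copy x: `F₂` prepares its mass to avoid x and y, the largest disc
    -- crosses from y to x, and `F₃` finishes in copy x. The copies other than x, y, z use `F₁`.
    -- Each copy hosts at most one recursive flow, so the bound stays 1.
    obtain ⟨F₁, h₁, b₁⟩ := ih z x y hx hy
    obtain ⟨F₂, h₂, b₂⟩ := ih x z y hx.symm hxy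
    obtain ⟨F₃, h₃, b₃⟩ := ih y x z hxy.symm hy.symm
    refine ⟨glue (fun e => if e = z then fun _ _ => 0 else if e = y then F₂ else
      if e = x then F₃ else F₁) (fun c d => if c = y ∧ d = x then 1 else 0),
      Transports.glue (d := fun e => if e = z then fun _ => 0 else
        if e = y then fun u => avoidInd x z u - avoidInd x y u else
        if e = x then fun u => avoidInd y x u - avoidInd y z u else
          fun u => avoidInd z x u - avoidInd z y u) ?_ ?_ ?_, glue_le zero_le_one ?_ ?_⟩
    · intro e
      split_ifs
      exacts [Transports.zero, h₂, h₃, h₁]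
    · intro c d
      split_ifs <;> norm_num
    · intro σ e
      have hs : ∑ d, avoidInd e d σ * ((if e = y ∧ d = x then (1 : ℝ) else 0) -
          if d = y ∧ e = x then 1 else 0) =
          (if e = y then avoidInd e x σ else 0) - if e = x then avoidInd e y σ else 0 := by
        simp_rw [mul_sub, sum_sub_distrib]
        congr 1
        · by_cases he : e = y <;> simp [he]
        · by_cases he : e = x <;> simp [he]
      rw [hs, avoidInd_snoc, avoidInd_snoc]
      have c₁ := avoidInd_comm x z σ
      have c₂ := avoidInd_comm x y σ
      have c₃ := avoidInd_comm y z σ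
      by_cases e₁ : e = z
      · subst e₁
        simp [hx, hy]
      by_cases e₂ : e = y
      · subst e₂
        simp [hxy.symm, e₁, c₁, c₂]
      by_cases e₃ : e = x
      · subst e₃
        simp only [hxy, e₁, c₂, c₃, if_true, if_false, or_true, or_false]
        ring
      · simp [e₁, e₂, e₃]
    · intro e u v
      split_ifs
      exacts [zero_le_one, b₂ u v, b₃ u v, b₁ u v]
    · intro c d
      split_ifs <;> norm_num

/-- Pass through the pair {x, a}: two shifts of load 1 each. -/
theorem exists_shift_pair {p : ℕ} (n : ℕ) (x y a b : Fin p) (hxy : x ≠ y) (hab : a ≠ b) :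
    ∃ F, Transports (hanoiGraph p n) F (fun u => avoidInd x y u - avoidInd a b u) ∧
      ∀ u v, F u v ≤ 2 := by
  rcases eq_or_ne x a with rfl | hxa
  · obtain ⟨F, h, hb⟩ := exists_shift n x y b hxy hab
    exact ⟨F, h, fun u v => (hb u v).trans one_le_two⟩
  · obtain ⟨F, h, hb⟩ := exists_shift n x y a hxy hxa
    obtain ⟨F', h', hb'⟩ := exists_shift n a x b hxa.symm hab
    refine ⟨_, (h.add h').congr fun u => ?_, fun u v => ?_⟩
    · rw [avoidInd_comm x a]
      ring
    · linarith [hb u v, hb' u v]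

/-- The unit mass of each vertex can be spread uniformly over the configurations that avoid two given
pegs, such that the total flow along an arc is at most a multiple of `(p / (p - 2)) ^ n`. -/
theorem exists_concentrate {p : ℕ} (hp : 3 ≤ p) (n : ℕ) (a b : Fin p) (hab : a ≠ b) :
    ∃ g : (Fin n → Fin p) → (Fin n → Fin p) → (Fin n → Fin p) → ℝ,
      (∀ s, Transports (hanoiGraph p n) (g s)
        fun u => (if u = s then 1 else 0) - (((p : ℝ) - 2) ^ n)⁻¹ * avoidInd a b u) ∧
      (∀ s u, g s u s = 0) ∧
      ∀ u v, ∑ s, g s u v ≤ p * ((p : ℝ) / (p - 2)) ^ n := by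
  have hp' : (3 : ℝ) ≤ p := by exact_mod_cast hp
  have hq : (0 : ℝ) < p - 2 := by linarith
  induction n generalizing a b with
  | zero =>
    refine ⟨fun _ _ _ => 0, fun s => Transports.zero.congr fun u => ?_, fun _ _ => rfl, ?_⟩
    · simp [Subsingleton.elim u s, avoidInd]
    · simp
  | succ n ih =>
    set q : ℝ := (p : ℝ) - 2 with hqdef
    set Q : Finset (Fin p) := {a, b}ᶜ with hQ
    have cardQ : (#Q : ℝ) = q := by
      rw [hQ, card_compl, card_pair hab, Fintype.card_fin, Nat.cast_sub (by omega), hqdef]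
      norm_num
    have memQ : ∀ e, e ∈ Q ↔ ¬ (e = a ∨ e = b) := fun e => by simp [hQ]
    let X : Fin p → Fin p → Fin p × Fin p := fun c e => if e = c then (a, b) else (c, e)
    have hX : ∀ c e, (X c e).1 ≠ (X c e).2 := by
      intro c e
      by_cases h : e = c
      · simpa [X, h] using hab
      · simpa [X, h] using Ne.symm h
    choose g hg hin hle using fun c e => ih (X c e).1 (X c e).2 (hX c e)
    -- After crossing from c to e, the mass is shifted from avoiding c, e to avoiding a, b.
    have hS : ∀ c e, ∃ F, Transports (hanoiGraph p n) F (fun u => if c ≠ e ∧ e ∈ Q then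
        avoidInd c e u - avoidInd a b u else 0) ∧ ∀ u v, F u v ≤ 2 := by
      intro c e
      by_cases h : c ≠ e ∧ e ∈ Q
      · obtain ⟨F, hF, hb⟩ := exists_shift_pair n c e a b h.1 hab
        exact ⟨F, hF.congr fun u => by rw [if_pos h], hb⟩
      · exact ⟨_, Transports.zero.congr fun u => by rw [if_neg h], fun _ _ => zero_le_two⟩
    choose S hS hS2 using hS
    have hk : 0 ≤ (q ^ (n + 1))⁻¹ := by positivity
    have hpn : ∀ k : ℝ, ∑ σ : Fin n → Fin p, k = (p : ℝ) ^ n * k := by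
      intro k
      simp
    let G : Fin p → (Fin n → Fin p) → Fin p → (Fin n → Fin p) → (Fin n → Fin p) → ℝ :=
      fun c s e u v => if e = c then q⁻¹ * ∑ e' ∈ Q, g c e' s u v
        else (q ^ (n + 1))⁻¹ * S c e u v
    let w : Fin p → Fin p → Fin p → ℝ := fun c x y => if x = c ∧ y ∈ Q then (q ^ (n + 1))⁻¹ else 0
    refine ⟨fun s => glue (G (s (Fin.last n)) (Fin.init s)) (w (s (Fin.last n))),
      forall_snoc fun s c => ?_, forall_snoc fun s c => forall_snoc fun σ x => ?_, ?_⟩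
    · simp only [Fin.snoc_last, Fin.init_snoc]
      refine Transports.glue (d := fun e u => if e = c then q⁻¹ * ∑ e' ∈ Q,
        ((if u = s then 1 else 0) - (q ^ n)⁻¹ * avoidInd (X c e').1 (X c e').2 u)
        else (q ^ (n + 1))⁻¹ * if c ≠ e ∧ e ∈ Q then
        avoidInd c e u - avoidInd a b u else 0) ?_ ?_ ?_
      · intro e
        by_cases h : e = c
        · simp only [G, h, if_true]
          exact (Transports.sum Q fun e' _ => hg c e' s).smul (by positivity)
        · simp only [G, h, if_false]
          exact (hS c e).smul hk
      · intro x y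
        simp only [w]
        split_ifs
        exacts [hk, le_rfl]
      · intro σ x
        rw [avoidInd_snoc]
        simp only [snoc_inj]
        by_cases h : x = c
        · subst h
          have h1 : ∑ y, avoidInd x y σ * (w x x y - w x y x) =
              ∑ y ∈ Q, (q ^ (n + 1))⁻¹ * if y = x then 0 else avoidInd x y σ := by
            rw [← sum_subset (subset_univ Q)]
            · refine sum_congr rfl fun y hy => ?_
              by_cases hyx : y = x
              · simp [hyx]
              · simp [hyx, w, hy, mul_comm]
            · intro y _ hy
              by_cases hyx : y = x
              · simp [hyx]
              · simp [hyx, w, hy]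
          have h2 : ∑ e' ∈ Q, avoidInd (X x e').1 (X x e').2 σ =
              (if x = a ∨ x = b then 0 else avoidInd a b σ) +
                ∑ y ∈ Q, if y = x then 0 else avoidInd x y σ := by
            have : ∀ y, avoidInd (X x y).1 (X x y).2 σ = (if y = x then avoidInd a b σ else 0) +
                if y = x then 0 else avoidInd x y σ := by
              intro y
              by_cases hyx : y = x <;> simp [X, hyx]
            simp_rw [this, sum_add_distrib, sum_ite_eq', memQ, ite_not]
          rw [h1, if_pos rfl, sum_sub_distrib, ← mul_sum, ← mul_sum, h2, sum_const, nsmul_eq_mul,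
            cardQ, pow_succ, mul_inv]
          simp only [and_true]
          field_simp
          ring
        · have h1 : ∑ y, avoidInd x y σ * (w c x y - w c y x) =
              - if x ∈ Q then (q ^ (n + 1))⁻¹ * avoidInd c x σ else 0 := by
            rw [sum_eq_single c]
            · by_cases hx : x ∈ Q <;> simp [w, h, hx, avoidInd_comm x c, mul_comm]
            · intro y _ hy
              simp [w, h, hy]
            · simp
          rw [h1, if_neg h, if_neg fun h' : σ = s ∧ x = c => h h'.2]
          by_cases hx : x ∈ Q
          · rw [if_pos (⟨Ne.symm h, hx⟩ : c ≠ x ∧ x ∈ Q), if_pos hx, if_neg ((memQ x).1 hx)]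
            ring
          · rw [if_neg fun h' : c ≠ x ∧ x ∈ Q => hx h'.2, if_neg hx, if_pos (not_not.1 (mt (memQ x).2 hx))]
            ring
    -- Moves of the largest disc only leave the source's copy, where the recursive flows already
    -- avoid entering the source.
    · simp only [Fin.snoc_last, Fin.init_snoc, glue_snoc]
      by_cases h : x = c
      · subst h
        simp [G, hin]
      · simp [h, w]
    · intro u v
      have hr : 0 < (p : ℝ) / q := by positivity
      have hr1 : 1 ≤ (p : ℝ) / q := by rw [one_le_div hq]; linarith
      have hpr : (p : ℝ) ^ n * (q ^ (n + 1))⁻¹ = q⁻¹ * ((p : ℝ) / q) ^ n := by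
        rw [div_pow, pow_succ]
        field_simp
      rw [sum_glue]
      refine glue_le (by positivity) (fun e u v => ?_) (fun x y => ?_) u v
      · rw [sum_snoc]
        simp only [Fin.snoc_last, Fin.init_snoc]
        have hc : ∀ c, ∑ s, G c s e u v ≤ (if e = c then p * ((p : ℝ) / q) ^ n else 0) +
            2 * (q⁻¹ * ((p : ℝ) / q) ^ n) := by
          intro c
          by_cases h : e = c
          · have : ∑ s, G c s e u v ≤ p * ((p : ℝ) / q) ^ n := by
              simp only [G, h, if_true]
              rw [← mul_sum, sum_comm, inv_mul_le_iff₀ hq, ← cardQ, ← nsmul_eq_mul]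
              refine sum_le_card_nsmul _ _ _ fun e' _ => ?_
              rw [cardQ]
              exact hle c e' u v
            rw [if_pos h]
            have : 0 ≤ 2 * (q⁻¹ * ((p : ℝ) / q) ^ n) := by positivity
            linarith
          · simp only [G, h, if_false]
            rw [hpn, zero_add, ← hpr, ← mul_assoc, mul_comm 2]
            exact mul_le_mul_of_nonneg_left (hS2 c e u v) (by positivity)
        -- Own spreading plus the shifts from p copies cost p (1 + 2/q) times (p/q)^n, and 1 + 2/q =
        -- p/q: this fixes both the rate and the factor p.
        refine (sum_le_sum fun c _ => hc c).trans (le_of_eq ?_)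
        rw [sum_add_distrib, sum_ite_eq, if_pos (mem_univ _), sum_const, card_univ,
          Fintype.card_fin, nsmul_eq_mul, pow_succ]
        field_simp
        rw [hqdef]
        ring
      · rw [sum_snoc]
        simp only [Fin.snoc_last]
        have hc : ∀ c, ∑ s : Fin n → Fin p, w c x y ≤
            if x = c then q⁻¹ * ((p : ℝ) / q) ^ n else 0 := by
          intro c
          rw [hpn]
          by_cases h : x = c
          · rw [if_pos h, ← hpr]
            refine mul_le_mul_of_nonneg_left ?_ (by positivity)
            simp only [w]
            split_ifs
            exacts [le_rfl, hk]
          · simp [w, h]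
        refine (sum_le_sum fun c _ => hc c).trans ?_
        rw [sum_ite_eq, if_pos (mem_univ _), pow_succ, ← mul_assoc, mul_right_comm,
          div_eq_mul_inv _ q]
        refine mul_le_mul_of_nonneg_right ?_ (by positivity)
        have : 0 ≤ q⁻¹ := by positivity
        nlinarith [mul_nonneg this (sub_nonneg.2 hp')]

/-! ### Uniform flows in general graphs and the cut bound -/

section general

variable {V : Type*} [Fintype V] {G : SimpleGraph V}

/-- `hM` covers graphs without arcs, where the supremum is 0. -/
theorem congestion_le {f : V → V → V → V → ℝ} {M : ℝ} (hM : 0 ≤ M)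
    (h : ∀ u v, ∑ s, ∑ t, f s t u v ≤ M) : congestion G f ≤ M / Fintype.card V := by
  rw [congestion, one_div, inv_mul_eq_div]
  exact div_le_div_of_nonneg_right (Real.iSup_le (fun a => h _ _) hM) (Nat.cast_nonneg _)

variable [DecidableRel G.Adj]

theorem sum_neighborFinset {F : V → ℝ} {u : V} (h : ∀ v, ¬ G.Adj u v → F v = 0) :
    ∑ v ∈ G.neighborFinset u, F v = ∑ v, F v :=
  sum_subset (subset_univ _) fun v _ hv => h v (by simpa using hv)

/-- Net outflow fixes only a difference; the source and sink conditions turn it into separate unit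
sums. -/
theorem IsUniformFlow.of_transports [DecidableEq V] {f : V → V → V → V → ℝ}
    (h : ∀ s t, Transports G (f s t) fun u => (if u = s then 1 else 0) - if u = t then 1 else 0)
    (diag : ∀ s u v, f s s u v = 0) (source_in : ∀ s t, s ≠ t → ∀ v, f s t v s = 0)
    (sink_out : ∀ s t, s ≠ t → ∀ v, f s t t v = 0) : IsUniformFlow G f := by
  have out : ∀ s t u, ∑ v ∈ G.neighborFinset u, f s t u v = ∑ v, f s t u v := fun s t u =>
    sum_neighborFinset fun v hv => (h s t).supported u v hv
  have inn : ∀ s t u, ∑ v ∈ G.neighborFinset u, f s t v u = ∑ v, f s t v u := fun s t u =>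
    sum_neighborFinset fun v hv => (h s t).supported v u fun a => hv a.symm
  refine ⟨fun s t => (h s t).nonneg, fun s t => (h s t).supported, diag, fun s t hst => ?_,
    fun s t hst => ?_, source_in, sink_out, fun s t _ v hs ht => ?_⟩
  · have := (h s t).net s
    simp only [source_in s t hst, hst, sum_const_zero, if_true, if_false] at this
    rw [out]
    linarith
  · have := (h s t).net t
    simp only [sink_out s t hst, hst.symm, sum_const_zero, if_true, if_false] at this
    rw [inn]
    linarith
  · have := (h s t).net v
    simp only [hs, ht, if_false] at this
    rw [out, inn]
    linarith

theorem IsUniformFlow.transports [DecidableEq V] {f : V → V → V → V → ℝ} (hf : IsUniformFlow G f)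
    (s t : V) :
    Transports G (f s t) fun u => (if u = s then 1 else 0) - if u = t then 1 else 0 := by
  have out : ∀ u, ∑ v ∈ G.neighborFinset u, f s t u v = ∑ v, f s t u v := fun u =>
    sum_neighborFinset fun v hv => hf.supported s t u v hv
  have inn : ∀ u, ∑ v ∈ G.neighborFinset u, f s t v u = ∑ v, f s t v u := fun u =>
    sum_neighborFinset fun v hv => hf.supported s t v u fun a => hv a.symm
  refine ⟨hf.nonneg s t, hf.supported s t, fun u => ?_⟩
  rcases eq_or_ne s t with rfl | hst
  · simp [hf.diag]
  by_cases hs : u = s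
  · subst hs
    rw [← out, hf.source_out u t hst]
    simp [hf.source_in u t hst, hst]
  by_cases ht : u = t
  · subst ht
    rw [← inn, hf.sink_in s u hst]
    simp [hf.sink_out s u hst, hs]
  · rw [← out, ← inn, hf.conserved s t hst u hs ht]
    simp [hs, ht]

theorem IsUniformFlow.congestion_nonneg {f : V → V → V → V → ℝ} (hf : IsUniformFlow G f) :
    0 ≤ congestion G f :=
  mul_nonneg (by positivity) (Real.iSup_nonneg fun _ =>
    sum_nonneg fun s _ => sum_nonneg fun t _ => hf.nonneg s t _ _)

theorem IsUniformFlow.sum_le [Nonempty V] {f : V → V → V → V → ℝ} (hf : IsUniformFlow G f) {ρ : ℝ}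
    (hρ : congestion G f ≤ ρ) (u v : V) :
    ∑ s, ∑ t, f s t u v ≤ if G.Adj u v then ρ * Fintype.card V else 0 := by
  split_ifs with h
  · have hc : (0 : ℝ) < Fintype.card V := by exact_mod_cast Fintype.card_pos
    rw [congestion, one_div, inv_mul_le_iff₀ hc, mul_comm] at hρ
    classical
    exact (le_ciSup (f := fun a : G.Dart => ∑ s, ∑ t, f s t a.fst a.snd)
      (Set.finite_range _).bddAbove ⟨(u, v), h⟩).trans hρ
  · simp [hf.supported _ _ u v h]

/-- Each of the |S| |Sᶜ| commodities from S to its complement sends at least one unit across the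
cut, each arc carries at most ρ |V|, and |Sᶜ| ≥ |V| / 2. -/
theorem IsUniformFlow.le_expansion [DecidableEq V] {f : V → V → V → V → ℝ}
    (hf : IsUniformFlow G f) {ρ : ℝ} (h0 : 0 < ρ) (hρ : congestion G f ≤ ρ)
    (hV : 2 ≤ Fintype.card V) : (2 * ρ)⁻¹ ≤ expansion G := by
  have : Nonempty V := Fintype.card_pos_iff.1 (by omega)
  have : Nonempty {S : Finset V // S.Nonempty ∧ 2 * S.card ≤ Fintype.card V} :=
    ⟨⟨{Classical.arbitrary V}, singleton_nonempty _, by simpa using hV⟩⟩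
  refine le_ciInf fun ⟨S, hS, hS2⟩ => ?_
  have key : (#S : ℝ) * #Sᶜ ≤ #(G.interedges S Sᶜ) * (ρ * Fintype.card V) := by
    have cross : ∀ s ∈ S, ∀ t ∈ Sᶜ, 1 ≤ ∑ u ∈ S, ∑ v ∈ Sᶜ, f s t u v := by
      intro s hs t ht
      have ht' : t ∉ S := mem_compl.1 ht
      have h1 : ∑ u ∈ S, (∑ v, f s t u v - ∑ v, f s t v u) = 1 := by
        simp_rw [(hf.transports s t).net, sum_sub_distrib, sum_ite_eq', hs, ht']
        norm_num
      simp_rw [← sum_add_sum_compl S, sum_sub_distrib, sum_add_distrib] at h1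
      -- Flow inside S cancels.
      rw [sum_comm (s := S) (t := S) (f := fun u v => f s t v u)] at h1
      have : 0 ≤ ∑ u ∈ S, ∑ v ∈ Sᶜ, f s t v u :=
        sum_nonneg fun u _ => sum_nonneg fun v _ => hf.nonneg s t v u
      linarith
    calc (#S : ℝ) * #Sᶜ = ∑ s ∈ S, ∑ t ∈ Sᶜ, (1 : ℝ) := by simp
      _ ≤ ∑ s ∈ S, ∑ t ∈ Sᶜ, ∑ u ∈ S, ∑ v ∈ Sᶜ, f s t u v :=
        sum_le_sum fun s hs => sum_le_sum fun t ht => cross s hs t ht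
      _ = ∑ u ∈ S, ∑ v ∈ Sᶜ, ∑ s ∈ S, ∑ t ∈ Sᶜ, f s t u v := by
        have := sum_comm (s := S ×ˢ Sᶜ) (t := S ×ˢ Sᶜ) (f := fun a b => f a.1 a.2 b.1 b.2)
        simpa only [sum_product] using this
      _ ≤ ∑ u ∈ S, ∑ v ∈ Sᶜ, ∑ s, ∑ t, f s t u v := by
        refine sum_le_sum fun u _ => sum_le_sum fun v _ => ?_
        refine (sum_le_sum fun s _ => sum_le_univ_sum_of_nonneg fun t => hf.nonneg s t u v).trans ?_
        exact sum_le_univ_sum_of_nonneg fun s => sum_nonneg fun t _ => hf.nonneg s t u v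
      _ ≤ ∑ u ∈ S, ∑ v ∈ Sᶜ, if G.Adj u v then ρ * Fintype.card V else 0 :=
        sum_le_sum fun u _ => sum_le_sum fun v _ => hf.sum_le hρ u v
      _ = #(G.interedges S Sᶜ) * (ρ * Fintype.card V) := by
        rw [← sum_product', ← sum_filter, sum_const, nsmul_eq_mul]
        rfl
  have hSpos : (0 : ℝ) < #S := by exact_mod_cast hS.card_pos
  have hVpos : (0 : ℝ) < Fintype.card V := by exact_mod_cast Fintype.card_pos
  have hc : (Fintype.card V : ℝ) ≤ 2 * #Sᶜ := by
    have := card_add_card_compl S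
    exact_mod_cast (by omega : Fintype.card V ≤ 2 * #Sᶜ)
  rw [le_div_iff₀ hSpos, inv_mul_le_iff₀ (by positivity)]
  refine le_of_mul_le_mul_right ?_ hVpos
  nlinarith

end general

/-! ### The recursion for Hanoi graphs -/

/-- Commodities within a copy follow `f`; the other ones spread out in the copy of their source,
cross to the copy of their target, and contract there. -/
theorem exists_flow_succ {p : ℕ} (hp : 3 ≤ p) (n : ℕ) (ρ : ℝ)
    (f : (Fin n → Fin p) → (Fin n → Fin p) → (Fin n → Fin p) → (Fin n → Fin p) → ℝ)
    (hf : IsUniformFlow (hanoiGraph p n) f) (hρ : congestion (hanoiGraph p n) f ≤ ρ) :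
    ∃ g, IsUniformFlow (hanoiGraph p (n + 1)) g ∧
      congestion (hanoiGraph p (n + 1)) g ≤ ρ + (p : ℝ) ^ 2 * ((p : ℝ) / (p - 2)) ^ (n + 1) := by
  have hp' : (3 : ℝ) ≤ p := by exact_mod_cast hp
  have hq : (0 : ℝ) < p - 2 := by linarith
  have : Nonempty (Fin p) := ⟨⟨0, by omega⟩⟩
  have hρ0 : 0 ≤ ρ := hf.congestion_nonneg.trans hρ
  have hfle : ∀ u v, ∑ s, ∑ t, f s t u v ≤ ρ * p ^ n := by
    intro u v
    refine (hf.sum_le hρ u v).trans ?_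
    split_ifs
    · simp
    · positivity
  have hconc : ∀ a b : Fin p, ∃ g : (Fin n → Fin p) → (Fin n → Fin p) → (Fin n → Fin p) → ℝ,
      a ≠ b → (∀ s, Transports (hanoiGraph p n) (g s)
        fun u => (if u = s then 1 else 0) - (((p : ℝ) - 2) ^ n)⁻¹ * avoidInd a b u) ∧
      (∀ s u, g s u s = 0) ∧
      ∀ u v, ∑ s, g s u v ≤ p * ((p : ℝ) / (p - 2)) ^ n := by
    intro a b
    by_cases hab : a = b
    · exact ⟨fun _ _ _ => 0, fun h => absurd hab h⟩
    · obtain ⟨g, hg⟩ := exists_concentrate hp n a b hab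
      exact ⟨g, fun _ => hg⟩
  choose c hc using hconc
  set q : ℝ := (p : ℝ) - 2
  set r : ℝ := (p : ℝ) / q with hrdef
  have hr : 0 < r := by positivity
  have hr1 : 1 ≤ r := by rw [hrdef, one_le_div hq]; linarith
  have hk : 0 ≤ (q ^ n)⁻¹ := by positivity
  let G : Fin p → Fin p → (Fin n → Fin p) → (Fin n → Fin p) → Fin p → (Fin n → Fin p) →
      (Fin n → Fin p) → ℝ := fun a b s t e u v =>
    if a = b then (if e = a then f s t u v else 0) else
      if e = a then c a b s u v else if e = b then c a b t v u else 0
  let w : Fin p → Fin p → Fin p → Fin p → ℝ := fun a b x y =>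
    if a ≠ b ∧ x = a ∧ y = b then (q ^ n)⁻¹ else 0
  have hpn : ∀ k : ℝ, ∑ σ : Fin n → Fin p, k = (p : ℝ) ^ n * k := by
    intro k
    simp
  refine ⟨fun s t => glue (G (s (Fin.last n)) (t (Fin.last n)) (Fin.init s) (Fin.init t))
    (w (s (Fin.last n)) (t (Fin.last n))), IsUniformFlow.of_transports ?_ ?_ ?_ ?_, ?_⟩
  · refine forall_snoc fun s a => forall_snoc fun t b => ?_
    simp only [Fin.snoc_last, Fin.init_snoc]
    refine Transports.glue (d := fun e u => if a = b then
      (if e = a then (if u = s then 1 else 0) - if u = t then 1 else 0 else 0) else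
      if e = a then (if u = s then 1 else 0) - (q ^ n)⁻¹ * avoidInd a b u else
      if e = b then -((if u = t then 1 else 0) - (q ^ n)⁻¹ * avoidInd a b u) else 0) ?_ ?_ ?_
    · intro e
      by_cases hab : a = b
      · by_cases ha : e = a
        · simpa only [G, if_pos hab, if_pos ha] using hf.transports s t
        · simpa only [G, if_pos hab, if_neg ha] using Transports.zero
      · by_cases ha : e = a
        · simpa only [G, if_neg hab, if_pos ha] using (hc a b hab).1 s
        · by_cases hb : e = b
          · simpa only [G, if_neg hab, if_neg ha, if_pos hb] using ((hc a b hab).1 t).reverse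
          · simpa only [G, if_neg hab, if_neg ha, if_neg hb] using Transports.zero
    · intro x y
      simp only [w]
      split_ifs
      exacts [hk, le_rfl]
    · intro σ x
      simp only [snoc_inj]
      by_cases hab : a = b
      · subst hab
        by_cases hx : x = a <;> simp [hx, w]
      · by_cases ha : x = a
        · subst ha
          have : ∑ y, avoidInd x y σ * (w x b x y - w x b y x) = avoidInd x b σ * (q ^ n)⁻¹ := by
            rw [sum_eq_single b]
            · simp [w, hab]
            · intro y _ hy
              simp [w, hab, hy]
            · simp
          rw [this]
          simp [hab]
          ring
        · by_cases hb : x = b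
          · subst hb
            have : ∑ y, avoidInd x y σ * (w a x x y - w a x y x) =
                -(avoidInd a x σ * (q ^ n)⁻¹) := by
              rw [sum_eq_single a]
              · simp [w, hab, ha, avoidInd_comm x a]
              · intro y _ hy
                simp [w, ha, hy]
              · simp
            rw [this]
            simp [hab, ha]
            ring
          · simp [hab, ha, hb, w]
  · refine forall_snoc fun s a => forall_snoc fun u x => forall_snoc fun v y => ?_
    simp [glue_snoc, G, w, hf.diag]
  · refine forall_snoc fun s a => forall_snoc fun t b => fun hst => forall_snoc fun v x => ?_
    simp only [Fin.snoc_last, Fin.init_snoc, glue_snoc]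
    by_cases hx : x = a
    · subst hx
      by_cases hab : x = b
      · subst hab
        have : s ≠ t := fun h => hst (by rw [h])
        simp [G, hf.source_in s t this]
      · simp [G, hab, (hc x b hab).2.1]
    · simp [hx, w]
  · refine forall_snoc fun s a => forall_snoc fun t b => fun hst => forall_snoc fun v x => ?_
    simp only [Fin.snoc_last, Fin.init_snoc, glue_snoc]
    by_cases hab : a = b
    · subst hab
      by_cases hx : a = x
      · subst hx
        have : s ≠ t := fun h => hst (by rw [h])
        simp [G, hf.sink_out s t this]
      · simp [hx, w]
    · by_cases hx : b = x
      · subst hx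
        simp [G, hab, Ne.symm hab, (hc a b hab).2.1]
      · simp [hx, w, Ne.symm hab]
  · have hM : 0 ≤ (p : ℝ) * (ρ * p ^ n) + p * (p * (p ^ n * (p * r ^ n))) := by positivity
    refine (congestion_le hM fun u v => ?_).trans ?_
    · rw [sum_snoc]
      -- The inner load is charged to every arc once for each a, though an arc lies in at most one
      -- copy; dividing by p^(n+1) still leaves only ρ.
      have hab : ∀ a b, ∑ s, ∑ t, glue (G a b s t) (w a b) u v ≤
          (if a = b then ρ * p ^ n else 0) + p ^ n * (p * r ^ n) := by
        intro a b
        simp_rw [sum_glue]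
        have h0 : 0 ≤ (p : ℝ) ^ n * (p * r ^ n) := by positivity
        by_cases hab : a = b
        · rw [if_pos hab]
          refine glue_le (by positivity) (fun e u v => ?_) (fun x y => ?_) u v
          · by_cases ha : e = a
            · simp only [G, if_pos hab, if_pos ha]
              linarith [hfle u v]
            · simp only [G, if_pos hab, if_neg ha, sum_const_zero]
              positivity
          · simp only [w, hab, ne_eq, not_true, false_and, if_false, sum_const_zero]
            positivity
        · rw [if_neg hab, zero_add]
          refine glue_le (by positivity) (fun e u v => ?_) (fun x y => ?_) u v
          · by_cases ha : e = a
            · simp only [G, if_neg hab, if_pos ha]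
              rw [sum_comm, hpn]
              exact mul_le_mul_of_nonneg_left ((hc a b hab).2.2 u v) (by positivity)
            · by_cases hb : e = b
              · simp only [G, if_neg hab, if_neg ha, if_pos hb]
                rw [hpn]
                exact mul_le_mul_of_nonneg_left ((hc a b hab).2.2 v u) (by positivity)
              · simp only [G, if_neg hab, if_neg ha, if_neg hb, sum_const_zero]
                positivity
          · rw [hpn, hpn]
            refine mul_le_mul_of_nonneg_left ?_ (by positivity)
            have h1 : w a b x y ≤ (q ^ n)⁻¹ := by
              simp only [w]
              split_ifs
              exacts [le_rfl, hk]
            have h2 : r ^ n = p ^ n * (q ^ n)⁻¹ := by rw [hrdef, div_pow, div_eq_mul_inv]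
            have h3 : (p : ℝ) ^ n * w a b x y ≤ r ^ n := by
              rw [h2]
              exact mul_le_mul_of_nonneg_left h1 (by positivity)
            refine h3.trans (le_mul_of_one_le_left (by positivity) (by linarith))
      have hsum : ∀ a, ∑ s : Fin n → Fin p, ∑ t : Fin (n + 1) → Fin p, glue (G a (t (Fin.last n)) s (Fin.init t))
          (w a (t (Fin.last n))) u v ≤ ρ * p ^ n + p * (p ^ n * (p * r ^ n)) := by
        intro a
        simp_rw [sum_snoc, Fin.snoc_last, Fin.init_snoc]
        rw [sum_comm]
        refine (sum_le_sum fun b _ => hab a b).trans (le_of_eq ?_)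
        rw [sum_add_distrib, sum_ite_eq, if_pos (mem_univ _)]
        simp
      simp only [Fin.snoc_last, Fin.init_snoc]
      refine (sum_le_sum fun a _ => hsum a).trans (le_of_eq ?_)
      simp
    · have hp0 : (0 : ℝ) < p := by linarith
      rw [Fintype.card_fun, Fintype.card_fin, Fintype.card_fin, Nat.cast_pow,
        div_le_iff₀ (by positivity)]
      have : r ^ n ≤ r ^ (n + 1) := pow_le_pow_right₀ hr1 (Nat.le_succ n)
      have h2 : (p : ℝ) ^ 2 * r ^ n ≤ p ^ 2 * r ^ (n + 1) :=
        mul_le_mul_of_nonneg_left this (by positivity)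
      refine le_trans (le_of_eq ?_) (mul_le_mul_of_nonneg_right (add_le_add_right h2 ρ)
        (by positivity : (0 : ℝ) ≤ p ^ (n + 1)))
      ring

/-- With r = p / (p - 2), the constant K = p³/2 solves K r^n + p² r^(n+1) = K r^(n+1), because r - 1
= 2 / (p - 2). -/
theorem exists_flow {p : ℕ} (hp : 3 ≤ p) (n : ℕ) :
    ∃ f, IsUniformFlow (hanoiGraph p n) f ∧
      congestion (hanoiGraph p n) f ≤ (p : ℝ) ^ 3 / 2 * ((p : ℝ) / (p - 2)) ^ n := by
  have hp' : (3 : ℝ) ≤ p := by exact_mod_cast hp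
  have hq : (0 : ℝ) < p - 2 := by linarith
  induction n with
  | zero =>
    refine ⟨fun _ _ _ _ => 0, .of_transports (fun s t => Transports.zero.congr fun u => ?_)
      (fun _ _ _ => rfl) (fun _ _ _ _ => rfl) (fun _ _ _ _ => rfl), ?_⟩
    · simp [Subsingleton.elim s t]
    · refine (congestion_le le_rfl fun u v => by simp).trans ?_
      simp
      positivity
  | succ n ih =>
    obtain ⟨f, hf, hc⟩ := ih
    obtain ⟨g, hg, hc'⟩ := exists_flow_succ hp n _ f hf hc
    refine ⟨g, hg, hc'.trans (le_of_eq ?_)⟩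
    have hr : (p : ℝ) / (p - 2) * (p - 2) = p := div_mul_cancel₀ _ hq.ne'
    rw [pow_succ]
    linear_combination -((p : ℝ) ^ 2 / 2 * ((p : ℝ) / (p - 2)) ^ n) * hr

end Hanoi

theorem mainTheorem3 (p : ℕ) (hp : 3 ≤ p) :
    (∃ C : ℝ, 0 < C ∧ ∀ (n : ℕ) (ρ : ℝ),
      (∃ f : (Fin n → Fin p) → (Fin n → Fin p) → (Fin n → Fin p) → (Fin n → Fin p) → ℝ,
        Hanoi.IsUniformFlow (Hanoi.hanoiGraph p n) f ∧
          Hanoi.congestion (Hanoi.hanoiGraph p n) f ≤ ρ) →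
      ∃ g : (Fin (n + 1) → Fin p) → (Fin (n + 1) → Fin p) → (Fin (n + 1) → Fin p) →
          (Fin (n + 1) → Fin p) → ℝ,
        Hanoi.IsUniformFlow (Hanoi.hanoiGraph p (n + 1)) g ∧
          Hanoi.congestion (Hanoi.hanoiGraph p (n + 1)) g
            ≤ ρ + C * ((p : ℝ) / ((p : ℝ) - 2)) ^ (n + 1)) ∧
    (∃ c : ℝ, 0 < c ∧ ∀ n : ℕ, 1 ≤ n →
      c * (((p : ℝ) - 2) / (p : ℝ)) ^ n ≤ Hanoi.expansion (Hanoi.hanoiGraph p n)) := by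
  have hp' : (3 : ℝ) ≤ p := by exact_mod_cast hp
  have hq : (0 : ℝ) < p - 2 := by linarith
  refine ⟨⟨(p : ℝ) ^ 2, by positivity, fun n ρ ⟨f, hf, hρ⟩ =>
    Hanoi.exists_flow_succ hp n ρ f hf hρ⟩, ((p : ℝ) ^ 3)⁻¹, by positivity, fun n hn => ?_⟩
  obtain ⟨f, hf, hc⟩ := Hanoi.exists_flow hp n
  have hV : 2 ≤ Fintype.card (Fin n → Fin p) := by
    rw [Fintype.card_fun, Fintype.card_fin, Fintype.card_fin]
    calc 2 ≤ p ^ 1 := by simpa using hp.trans' (by norm_num)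
      _ ≤ p ^ n := Nat.pow_le_pow_right (by omega) hn
  refine le_trans (le_of_eq ?_) (hf.le_expansion (by positivity) hc hV)
  rw [← inv_div (p : ℝ) (p - 2), inv_pow, ← mul_inv]
  congr 1
  ring
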